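/- Let $\mathcal X,\mathcal Y$ be measurable spaces, $\rho$ a probability measure on $\mathcal Z=\mathcal X\times\mathcal Y$, $H$ a real Hilbert space (for instance the reproducing kernel Hilbert space of a kernel on $\mathcal X$), and $\phi:\mathcal X\to H$ a feature map with $\sup_x\|\phi(x)\|<\infty$. Let $n,c\ge 1$ be integers with $nc\ge 2$, and let $\mathcal W=H^c$ with the inner product $\langle \mathbf w,\mathbf v\rangle=\sum_{j=1}^c\langle \mathbf w_j,\mathbf v_j\rangle$. For $\mathbf w\in\mathcal W$ put $h^{\mathbf w}(x)=(\langle \mathbf w_1,\phi(x)\rangle,\dots,\langle \mathbf w_c,\phi(x)\rangle)\in\mathbb R^c$. Let $\|\cdot\|$ be a norm on $\mathcal W$ with $\|\mathbf w\|\ge\max_{j}\|\mathbf w_j\|_H$ for all $\mathbf w$, and let $\|\mathbf v\|_*=\sup\{\langle \mathbf w,\mathbf v\rangle:\|\mathbf w\|\le 1\}$ be its dual norm. Let $L,\sigma,\Lambda>0$ and let $\ell:\mathcal W\times\mathcal Z\to\mathbb R$ and $r:\mathcal W\to\mathbb R$ satisfy: (i) $|\ell(\mathbf w;z)-\ell(\mathbf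 w';z)|\le L\max_{j}|h^{\mathbf w}_j(x)-h^{\mathbf w'}_j(x)|$ for all $\mathbf w,\mathbf w'\in\mathcal W$ and $z=(x,y)\in\mathcal Z$; (ii) $\mathbf w\mapsto\ell(\mathbf w;z)$ is convex for every $z$, and $z\mapsto\ell(\mathbf w;z)$ is $\rho$-integrable for every $\mathbf w$; (iii) $r$ is $\sigma$-strongly convex with respect to $\|\cdot\|$: for every $\mathbf w'\in\mathcal W$ there is a subgradient $r'(\mathbf w')\in\mathcal W$ with $r(\mathbf w)\ge r(\mathbf w')+\langle \mathbf w-\mathbf w',r'(\mathbf w')\rangle+\frac{\sigma}{2}\|\mathbf w-\mathbf w'\|^2$ for all $\mathbf w\in\mathcal W$. Let $F(\mathbf w)=\mathbb E_{Z\sim\rho}[\ell(\mathbf w;Z)]+r(\mathbf w)$, let $\mathbf w^*$ be a minimizer of $F$ over $\mathcal W$, and let $\mathcal F_\Lambda=\{z\mapsto\ell(\mathbf w;z):\mathbf w\in\mathcal W,\ F(\mathbf w)-F(\mathbf w^*)\le\Lambda\}$. Then for every sample $S=(z_1,\dots,z_n)\in\mathcal Z^n$ the empirical Rademacher complexity $\mathfrak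 R_S(\mathcal F_\Lambda)=\mathbb E_{\epsilon}\big[\sup_{f\in\mathcal F_\Lambda}\frac1n\sum_{i=1}^n\epsilon_i f(z_i)\big]$, where $\epsilon_1,\dots,\epsilon_n$ are independent uniform random signs, satisfies $$\mathfrak R_S(\mathcal F_\Lambda)\le\frac{C_1L\sqrt{2\Lambda}\,\widetilde B\,\log^2(nc)}{\sqrt{n\sigma}},\qquad \widetilde B=\sup_{x\in\mathcal X,\ 1\le j\le c}\|\tilde\phi_j(x)\|_*,$$ where $\tilde\phi_j(x)=(0,\dots,0,\phi(x),0,\dots,0)\in\mathcal W$ has $\phi(x)$ in block $j$, and $C_1>0$ is a universal constant (in particular independent of $n$, $c$, $L$ and $\Lambda$). -/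

import Mathlib

open MeasureTheory
open scoped InnerProductSpace

noncomputable section

namespace VectorLearning

/-- The hypothesis space `𝒲 = H^c` of tuples `w = (w_1, …, w_c)`, with the inner product
`⟪w, v⟫ = ∑ j, ⟪w_j, v_j⟫`. -/
abbrev HypSpace (H : Type*) (c : ℕ) : Type _ := PiLp 2 (fun _ : Fin c => H)

section

variable {𝒳 𝒴 H : Type*} [NormedAddCommGroup H] [InnerProductSpace ℝ H] {c : ℕ}

/-- The vector-valued predictor `h^w(x) = (⟪w_1, φ x⟫, …, ⟪w_c, φ x⟫)`. The type `Fin c → ℝ`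
carries the norm `‖t‖_∞ = max_j |t_j|`. -/
def predictor (φ : 𝒳 → H) (w : HypSpace H c) (x : 𝒳) : Fin c → ℝ :=
  fun j => ⟪w j, φ x⟫_ℝ

/-- The block feature map `p̃_j(x) = (0, …, 0, φ x, 0, …, 0)`, with `φ x` in block `j`. -/
def blockFeature (φ : 𝒳 → H) (j : Fin c) (x : 𝒳) : HypSpace H c :=
  PiLp.single 2 j (φ x)

/-- The norm `‖w‖_{2,∞} = max_j ‖w_j‖`. -/
def normTwoInf (w : HypSpace H c) : ℝ := ⨆ j, ‖w j‖

/-- The dual norm `‖v‖_* = sup {⟪w, v⟫ : N w ≤ 1}` of a norm `N` on `𝒲`. -/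
def dualNorm (N : Seminorm ℝ (HypSpace H c)) (v : HypSpace H c) : ℝ :=
  sSup {t : ℝ | ∃ w : HypSpace H c, N w ≤ 1 ∧ t = ⟪w, v⟫_ℝ}

/-- The quantity `B̃ = sup_{(x, j)} ‖p̃_j(x)‖_*`. -/
def supDualNorm (N : Seminorm ℝ (HypSpace H c)) (φ : 𝒳 → H) : ℝ :=
  ⨆ q : 𝒳 × Fin c, dualNorm N (blockFeature φ q.2 q.1)

/-- `ℓ` is `L`-Lipschitz with respect to the `ℓ_∞` norm of the prediction:
`|ℓ(w; z) - ℓ(w'; z)| ≤ L ‖h^w(x) - h^{w'}(x)‖_∞` for all `w, w'` and all `z = (x, y)`. -/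
def LossLipschitz (φ : 𝒳 → H) (ℓ : HypSpace H c → 𝒳 × 𝒴 → ℝ) (L : ℝ) : Prop :=
  ∀ (w w' : HypSpace H c) (z : 𝒳 × 𝒴),
    |ℓ w z - ℓ w' z| ≤ L * ‖predictor φ w z.1 - predictor φ w' z.1‖

/-- `r` is `σ`-strongly convex with respect to the norm `N`: at every point `w'` there is a
subgradient `g` with `r w ≥ r w' + ⟪w - w', g⟫ + (σ / 2) (N (w - w'))²` for all `w`. -/
def StronglyConvex (r : HypSpace H c → ℝ) (σ : ℝ) (N : Seminorm ℝ (HypSpace H c)) : Prop :=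
  ∀ w' : HypSpace H c, ∃ g : HypSpace H c, ∀ w : HypSpace H c,
    r w' + ⟪w - w', g⟫_ℝ + σ / 2 * N (w - w') ^ 2 ≤ r w

/-- The regularized risk `F(w) = 𝔼_Z[ℓ(w; Z)] + r(w)` with `Z` distributed as `ρ`. -/
def regRisk [MeasurableSpace 𝒳] [MeasurableSpace 𝒴] (ρ : Measure (𝒳 × 𝒴))
    (ℓ : HypSpace H c → 𝒳 × 𝒴 → ℝ) (r : HypSpace H c → ℝ) (w : HypSpace H c) : ℝ :=
  (∫ z, ℓ w z ∂ρ) + r w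

/-- The sublevel set `𝒲_Λ = {w : F w - F w* ≤ Λ}`. -/
def sublevel (F : HypSpace H c → ℝ) (wstar : HypSpace H c) (Λ : ℝ) : Set (HypSpace H c) :=
  {w | F w - F wstar ≤ Λ}

/-- The class `{z ↦ ℓ(w; z) : w ∈ W}` of loss functions. -/
def lossClass (ℓ : HypSpace H c → 𝒳 × 𝒴 → ℝ) (W : Set (HypSpace H c)) : Set (𝒳 × 𝒴 → ℝ) :=
  {f | ∃ w ∈ W, f = ℓ w}

end

/-- The empirical Rademacher complexity
`ℜ_S(𝓗) = 𝔼_ε [sup_{h ∈ 𝓗} (1/n) ∑ i, ε_i h(z_i)]` of `𝓗` on the sample `S = (z_1, …, z_n)`.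
The expectation over the `n` independent uniform signs is the average over all the `2 ^ n` sign
vectors. -/
def empiricalRademacher {𝒵 : Type*} {n : ℕ} (𝓗 : Set (𝒵 → ℝ)) (S : Fin n → 𝒵) : ℝ :=
  (1 / 2 ^ n : ℝ) * ∑ ε : Fin n → ℤˣ,
    sSup {t : ℝ | ∃ h ∈ 𝓗, t = (1 / n : ℝ) * ∑ i, ((ε i : ℤ) : ℝ) * h (S i)}

end VectorLearning

end

/-! Strong convexity places the sublevel set in an `N`-ball of radius `2 * √(Λ / σ)` about the
minimizer, so the predictions on the sample lie within `D = 2 * √(Λ / σ) * B` of those at the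
minimizer, in the max norm over the `n * c` pairs (sample point, block). By the Lipschitz condition
this is the only metric that matters.

The covering numbers come from an online learning argument (`MidpointStronglyConvex.exists_net`):
mirror descent chasing an unknown `w` makes `O(Λ * B ^ 2 / (σ * ε ^ 2))` mistakes before it predicts
within `ε`, and each correction is one of at most `2 * n * c + 1` vectors. The log-cardinality at
scale `D / 2 ^ k` is thus of order `4 ^ k * log (n * c)`, whatever the dimension of `H`.

In the chaining sum (`sum_signs_le_of_nets`) every scale then contributes the same amount, of order
`L * D * √(n * log (n * c))`, and about `log (n * c)` scales suffice. The resulting power 3/2 of the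
logarithm is relaxed to 2. -/

namespace VectorLearning

/-! ### Rademacher averages: finite classes and chaining -/

section FiniteClass

variable {n : ℕ}

lemma sum_signs_mul (a : Fin n → ℝ) :
    ∑ ε : Fin n → ℤˣ, ∑ i, ((ε i : ℤ) : ℝ) * a i = 0 := by
  have h := Equiv.sum_comp (Equiv.neg (Fin n → ℤˣ)) (fun ε : Fin n → ℤˣ => ∑ i, ((ε i : ℤ) : ℝ) * a i)
  simp only [Equiv.neg_apply, Pi.neg_apply, Units.val_neg, Int.cast_neg, neg_mul,
    Finset.sum_neg_distrib] at h
  linarith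

lemma sum_signs_exp_le (a : Fin n → ℝ) :
    ∑ ε : Fin n → ℤˣ, Real.exp (∑ i, ((ε i : ℤ) : ℝ) * a i)
      ≤ 2 ^ n * Real.exp ((∑ i, a i ^ 2) / 2) := by
  have h : ∑ ε : Fin n → ℤˣ, Real.exp (∑ i, ((ε i : ℤ) : ℝ) * a i)
      = ∏ i, (2 * Real.cosh (a i)) := by
    simp_rw [Real.exp_sum]
    rw [← Fintype.piFinset_univ,
      ← Finset.prod_univ_sum (fun _ => Finset.univ)
        (fun i (u : ℤˣ) => Real.exp (((u : ℤ) : ℝ) * a i))]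
    refine Finset.prod_congr rfl fun i _ => ?_
    rw [Real.cosh_eq, show (Finset.univ : Finset ℤˣ) = {1, -1} from rfl,
      Finset.sum_pair (by decide)]
    simp
    ring
  rw [h, Finset.prod_mul_distrib, Finset.sum_div, Real.exp_sum]
  simp only [Finset.prod_const, Finset.card_univ, Fintype.card_fin]
  gcongr with i
  exact Real.cosh_le_exp_half_sq _

/-- The finite class lemma for Rademacher averages. -/
lemma sum_signs_sup'_le {α : Type*} (T : Finset α) (hT : T.Nonempty) (g : α → Fin n → ℝ)
    {a s : ℝ} (hn : 0 < n) (ha : 0 < a) (hs : 0 < s) (hg : ∀ t ∈ T, ∀ i, |g t i| ≤ a)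
    (hcard : (T.card : ℝ) ≤ Real.exp s) :
    ∑ ε : Fin n → ℤˣ, T.sup' hT (fun t => ∑ i, ((ε i : ℤ) : ℝ) * g t i)
      ≤ 2 ^ n * (a * √(2 * n * s)) := by
  have hn' : (0 : ℝ) < n := by exact_mod_cast hn
  set q := √(2 * n * s) with hq
  have hq0 : 0 < q := Real.sqrt_pos.2 (by positivity)
  have hq2 : q ^ 2 = 2 * n * s := Real.sq_sqrt (by positivity)
  -- This choice gives `l ^ 2 * n * a ^ 2 / 2 = s`: the exponential moment of each element balances
  -- the bound `exp s` on the cardinality.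
  set l := q / (n * a) with hl
  have hl0 : 0 < l := by positivity
  have hls : l ^ 2 * (n * a ^ 2) / 2 = s := by
    rw [hl]; field_simp; linarith
  set X : (Fin n → ℤˣ) → ℝ := fun ε => T.sup' hT (fun t => ∑ i, ((ε i : ℤ) : ℝ) * g t i)
  -- The tangent line of `exp` at `2 * s` replaces Jensen's inequality; after averaging, the
  -- exponential term is at most 1.
  have h1 : ∀ ε, l * X ε ≤ (2 * s - 1) +
      Real.exp (-(2 * s)) * ∑ t ∈ T, Real.exp (∑ i, ((ε i : ℤ) : ℝ) * (l * g t i)) := by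
    intro ε
    obtain ⟨t, ht, hX⟩ := Finset.exists_mem_eq_sup' hT (fun t => ∑ i, ((ε i : ℤ) : ℝ) * g t i)
    have hle : Real.exp (l * X ε) ≤ ∑ t ∈ T, Real.exp (∑ i, ((ε i : ℤ) : ℝ) * (l * g t i)) := by
      have : l * X ε = ∑ i, ((ε i : ℤ) : ℝ) * (l * g t i) := by
        simp only [X, hX, Finset.mul_sum]
        exact Finset.sum_congr rfl fun i _ => by ring
      rw [this]
      exact Finset.single_le_sum
        (f := fun t => Real.exp (∑ i, ((ε i : ℤ) : ℝ) * (l * g t i)))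
        (fun _ _ => (Real.exp_pos _).le) ht
    have h2 := Real.add_one_le_exp (l * X ε - 2 * s)
    rw [sub_eq_neg_add (l * X ε) (2 * s), Real.exp_add] at h2
    have h3 := mul_le_mul_of_nonneg_left hle (Real.exp_pos (-(2 * s))).le
    linarith
  have h2 : ∀ t ∈ T, ∑ ε : Fin n → ℤˣ, Real.exp (∑ i, ((ε i : ℤ) : ℝ) * (l * g t i))
      ≤ 2 ^ n * Real.exp s := by
    intro t ht
    refine (sum_signs_exp_le _).trans ?_
    gcongr
    rw [← hls]
    gcongr
    calc ∑ i, (l * g t i) ^ 2 ≤ ∑ _i : Fin n, l ^ 2 * a ^ 2 := by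
          refine Finset.sum_le_sum fun i _ => ?_
          rw [mul_pow]
          refine mul_le_mul_of_nonneg_left ?_ (sq_nonneg l)
          exact sq_le_sq' (neg_le_of_abs_le (hg t ht i)) (le_of_abs_le (hg t ht i))
      _ = l ^ 2 * (n * a ^ 2) := by simp; ring
  have hcardE : (Fintype.card (Fin n → ℤˣ) : ℝ) = 2 ^ n := by simp
  have h3 : l * ∑ ε, X ε ≤ 2 ^ n * (2 * s) := by
    calc l * ∑ ε, X ε = ∑ ε, l * X ε := Finset.mul_sum _ _ _
      _ ≤ ∑ ε : Fin n → ℤˣ, ((2 * s - 1) + Real.exp (-(2 * s)) *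
            ∑ t ∈ T, Real.exp (∑ i, ((ε i : ℤ) : ℝ) * (l * g t i))) :=
          Finset.sum_le_sum fun ε _ => h1 ε
      _ = 2 ^ n * (2 * s - 1) + Real.exp (-(2 * s)) * ∑ t ∈ T, ∑ ε : Fin n → ℤˣ,
            Real.exp (∑ i, ((ε i : ℤ) : ℝ) * (l * g t i)) := by
          rw [Finset.sum_add_distrib, ← Finset.mul_sum, Finset.sum_comm, Finset.sum_const,
            Finset.card_univ, nsmul_eq_mul, hcardE]
      _ ≤ 2 ^ n * (2 * s - 1) + Real.exp (-(2 * s)) * ∑ t ∈ T, 2 ^ n * Real.exp s := by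
          gcongr with t ht
          exact h2 t ht
      _ = 2 ^ n * (2 * s - 1) + 2 ^ n * (Real.exp (-(2 * s)) * (T.card * Real.exp s)) := by
          rw [Finset.sum_const, nsmul_eq_mul]; ring
      _ ≤ 2 ^ n * (2 * s - 1) + 2 ^ n * (Real.exp (-(2 * s)) * (Real.exp s * Real.exp s)) := by
          gcongr
      _ = 2 ^ n * (2 * s) := by
          rw [← Real.exp_add, ← Real.exp_add, show -(2 * s) + (s + s) = 0 by ring, Real.exp_zero]
          ring
  have h4 : 2 ^ n * (2 * s) = l * (2 ^ n * (a * q)) := by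
    rw [hl]; field_simp; linarith
  rw [h4] at h3
  exact le_of_mul_le_mul_left h3 hl0

/-- Dyadic chaining for Rademacher averages of a class that is Lipschitz with respect to a
pseudometric in which it has finite nets `T k` at the scales `D / 2 ^ k`. -/
lemma sum_signs_le_of_nets {V E : Type*} [PseudoMetricSpace E] (h : V → E) (f : V → Fin n → ℝ)
    {L D s : ℝ} (hn : 0 < n) (hL : 0 < L) (hD : 0 < D) (hs : 0 < s)
    (hf : ∀ u v i, |f u i - f v i| ≤ L * dist (h u) (h v))
    (W : Set V) (hW : W.Nonempty) (w₀ : V) (T : ℕ → Finset V) (hT₀ : T 0 = {w₀})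
    (hcard : ∀ k, ((T k).card : ℝ) ≤ Real.exp (3 * 4 ^ k * s))
    (hT : ∀ k, ∀ w ∈ W, ∃ v ∈ T k, dist (h w) (h v) ≤ D / 2 ^ k) (M : ℕ) (hM : n ≤ 2 ^ M)
    (X : (Fin n → ℤˣ) → ℝ)
    (hX : ∀ ε c, (∀ w ∈ W, ∑ i, ((ε i : ℤ) : ℝ) * f w i ≤ c) → X ε ≤ c) :
    ∑ ε, X ε ≤ 2 ^ n * (L * D * √n * (3 * M * √(8 * s) + 1)) := by
  classical
  have hn' : (0 : ℝ) < n := by exact_mod_cast hn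
  -- Links between consecutive nets; the factor 3 is the triangle inequality through `w`, since `D /
  -- 2 ^ k` is twice the finer scale.
  set P : ℕ → Finset (V × V) := fun k => (T (k + 1) ×ˢ T k).filter
    fun p => dist (h p.1) (h p.2) ≤ 3 * (D / 2 ^ (k + 1)) with hP
  choose! π hπT hπ using hT
  have hπP : ∀ k, ∀ w ∈ W, (π (k + 1) w, π k w) ∈ P k := by
    intro k w hw
    simp only [hP, Finset.mem_filter, Finset.mem_product]
    refine ⟨⟨hπT _ _ hw, hπT _ _ hw⟩, ?_⟩
    have h1 := hπ (k + 1) w hw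
    have h2 := hπ k w hw
    have h3 := dist_triangle_left (h (π (k + 1) w)) (h (π k w)) (h w)
    have h4 : D / 2 ^ k = 2 * (D / 2 ^ (k + 1)) := by rw [pow_succ]; field_simp
    linarith
  have hPne : ∀ k, (P k).Nonempty := fun k => ⟨_, hπP k _ hW.some_mem⟩
  set Y : ℕ → (Fin n → ℤˣ) → ℝ := fun k ε => (P k).sup' (hPne k)
    (fun p => ∑ i, ((ε i : ℤ) : ℝ) * (f p.1 i - f p.2 i)) with hY
  have hYbound : ∀ k, ∑ ε, Y k ε ≤ 2 ^ n * (3 * L * D * √n * √(8 * s)) := by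
    intro k
    have hc : ((P k).card : ℝ) ≤ Real.exp (4 * 4 ^ (k + 1) * s) := by
      calc ((P k).card : ℝ) ≤ ((T (k + 1) ×ˢ T k).card : ℝ) := by
            exact_mod_cast Finset.card_filter_le _ _
        _ = (T (k + 1)).card * (T k).card := by rw [Finset.card_product]; push_cast; rfl
        _ ≤ Real.exp (3 * 4 ^ (k + 1) * s) * Real.exp (3 * 4 ^ k * s) := by
            gcongr
            · exact hcard _
            · exact hcard _
        _ ≤ Real.exp (4 * 4 ^ (k + 1) * s) := by
            rw [← Real.exp_add]
            gcongr
            have : 0 < (4 : ℝ) ^ k * s := by positivity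
            rw [pow_succ]
            nlinarith
    have := sum_signs_sup'_le (P k) (hPne k) (fun p i => f p.1 i - f p.2 i)
      (a := L * (3 * (D / 2 ^ (k + 1)))) (s := 4 * 4 ^ (k + 1) * s) hn (by positivity)
      (by positivity)
      (fun p hp i => (hf _ _ _).trans
        (mul_le_mul_of_nonneg_left (Finset.mem_filter.1 hp).2 hL.le)) hc
    refine this.trans (le_of_eq ?_)
    -- The root of the entropy grows by the factor `2 ^ (k + 1)` by which the link length shrinks,
    -- so the bound does not depend on `k`.
    have h2 : √(2 * n * (4 * 4 ^ (k + 1) * s)) = √n * √(8 * s) * 2 ^ (k + 1) := by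
      rw [show 2 * n * (4 * 4 ^ (k + 1) * s) = n * (8 * s) * (2 ^ (k + 1)) ^ 2 by
        rw [← pow_mul, mul_comm (k + 1) 2, pow_mul]; norm_num; ring,
        Real.sqrt_mul (by positivity), Real.sqrt_mul (by positivity),
        Real.sqrt_sq (by positivity)]
    rw [h2]
    field_simp
  have hchain : ∀ ε, X ε ≤ ∑ i, ((ε i : ℤ) : ℝ) * f w₀ i + ∑ k ∈ Finset.range M, Y k ε +
      L * D := by
    intro ε
    refine hX ε _ fun w hw => ?_
    have h0 : π 0 w = w₀ := by
      have := hπT 0 w hw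
      rwa [hT₀, Finset.mem_singleton] at this
    set S : V → ℝ := fun v => ∑ i, ((ε i : ℤ) : ℝ) * f v i with hS
    have htel := Finset.sum_range_sub (fun k => S (π k w)) M
    have hk : ∀ k ∈ Finset.range M, S (π (k + 1) w) - S (π k w) ≤ Y k ε := by
      intro k _
      have := Finset.le_sup' (fun p : V × V => ∑ i, ((ε i : ℤ) : ℝ) * (f p.1 i - f p.2 i))
        (hπP k w hw)
      refine le_trans (le_of_eq ?_) this
      simp only [hS, ← Finset.sum_sub_distrib, mul_sub]
    have hsum := Finset.sum_le_sum hk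
    have hlast : S w - S (π M w) ≤ L * D := by
      calc S w - S (π M w) = ∑ i, ((ε i : ℤ) : ℝ) * (f w i - f (π M w) i) := by
            simp only [hS, ← Finset.sum_sub_distrib, mul_sub]
        _ ≤ ∑ _i : Fin n, L * (D / 2 ^ M) := by
            refine Finset.sum_le_sum fun i _ => ?_
            refine (le_abs_self _).trans ?_
            have h1 : |((ε i : ℤ) : ℝ)| = 1 := by
              rcases Int.units_eq_one_or (ε i) with h | h <;> simp [h]
            rw [abs_mul, h1, one_mul]
            exact (hf _ _ _).trans (mul_le_mul_of_nonneg_left (hπ M w hw) hL.le)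
        _ = L * D * (n / 2 ^ M) := by simp; ring
        _ ≤ L * D * 1 := by
            gcongr
            rw [div_le_one (by positivity)]
            exact_mod_cast hM
        _ = L * D := mul_one _
    rw [h0] at htel
    change S w ≤ S w₀ + _ + _
    linarith
  calc ∑ ε, X ε ≤ ∑ ε : Fin n → ℤˣ, (∑ i, ((ε i : ℤ) : ℝ) * f w₀ i +
        ∑ k ∈ Finset.range M, Y k ε + L * D) := Finset.sum_le_sum fun ε _ => hchain ε
    _ = ∑ k ∈ Finset.range M, ∑ ε, Y k ε + 2 ^ n * (L * D) := by
        rw [Finset.sum_add_distrib, Finset.sum_add_distrib, sum_signs_mul, zero_add,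
          Finset.sum_comm]
        simp
    _ ≤ ∑ k ∈ Finset.range M, 2 ^ n * (3 * L * D * √n * √(8 * s)) + 2 ^ n * (L * D * √n) := by
        refine add_le_add (Finset.sum_le_sum fun k _ => hYbound k)
          (mul_le_mul_of_nonneg_left ?_ (by positivity))
        · refine le_mul_of_one_le_right (by positivity) ?_
          rw [Real.one_le_sqrt]
          exact_mod_cast hn
    _ = _ := by simp; ring

end FiniteClass

/-! ### Strong convexity, conjugates and covering numbers -/

section Nets

variable {V : Type*} [NormedAddCommGroup V] [InnerProductSpace ℝ V]

/-- Midpoint form of `σ`-strong convexity with respect to the seminorm `N`. -/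
def MidpointStronglyConvex (F : V → ℝ) (σ : ℝ) (N : Seminorm ℝ V) : Prop :=
  ∀ u v, 2 * F (midpoint ℝ u v) + σ / 4 * N (u - v) ^ 2 ≤ F u + F v

/-- The Fenchel conjugate. -/
noncomputable def conjugate (F : V → ℝ) (θ : V) : ℝ := ⨆ w, (⟪w, θ⟫_ℝ - F w)

variable {F : V → ℝ} {σ : ℝ} {N : Seminorm ℝ V} {w₀ : V}

lemma mul_sub_quarter_sq_le (hσ : 0 < σ) (b t : ℝ) : b * t - σ / 4 * t ^ 2 ≤ b ^ 2 / σ := by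
  rw [le_div_iff₀ hσ]
  nlinarith [sq_nonneg (σ * t / 2 - b)]

lemma MidpointStronglyConvex.add_le_of_isMinOn (hF : MidpointStronglyConvex F σ N)
    (hw₀ : IsMinOn F Set.univ w₀) (w : V) : F w₀ + σ / 4 * N (w - w₀) ^ 2 ≤ F w := by
  have h1 := hF w w₀
  have h2 : F w₀ ≤ F (midpoint ℝ w w₀) := hw₀ (Set.mem_univ _)
  linarith

/-- Quadratic growth beats the linear term, so the real supremum in `conjugate` is a genuine one. -/
lemma MidpointStronglyConvex.bddAbove (hF : MidpointStronglyConvex F σ N) (hσ : 0 < σ)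
    (hw₀ : IsMinOn F Set.univ w₀) (hN : ∀ θ : V, ∃ b : ℝ, ∀ w, ⟪w, θ⟫_ℝ ≤ b * N w) (θ : V) :
    BddAbove (Set.range fun w => ⟪w, θ⟫_ℝ - F w) := by
  obtain ⟨b, hb⟩ := hN θ
  refine ⟨⟪w₀, θ⟫_ℝ - F w₀ + b ^ 2 / σ, ?_⟩
  rintro _ ⟨w, rfl⟩
  have h1 := hF.add_le_of_isMinOn hw₀ w
  have h2 := hb (w - w₀)
  have h3 := mul_sub_quarter_sq_le hσ b (N (w - w₀))
  rw [inner_sub_left] at h2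
  simp only
  linarith

/-- Smoothness of the conjugate, with a `δ`-maximizer `x` in the role of the gradient, so attainment
is not needed. The midpoint of `w` and `x` competes in the supremum at `θ`, and strong convexity
absorbs the term in `w - x`. -/
lemma MidpointStronglyConvex.conjugate_add_le (hF : MidpointStronglyConvex F σ N) (hσ : 0 < σ)
    (hw₀ : IsMinOn F Set.univ w₀) (hN : ∀ θ : V, ∃ b : ℝ, ∀ w, ⟪w, θ⟫_ℝ ≤ b * N w)
    {θ v x : V} {b δ : ℝ} (hx : conjugate F θ - δ ≤ ⟪x, θ⟫_ℝ - F x)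
    (hv : ∀ w, ⟪w, v⟫_ℝ ≤ b * N w) :
    conjugate F (θ + v) ≤ conjugate F θ + δ + ⟪x, v⟫_ℝ + b ^ 2 / σ := by
  refine ciSup_le fun w => ?_
  have h1 := hF w x
  have h2 : ⟪midpoint ℝ w x, θ⟫_ℝ - F (midpoint ℝ w x) ≤ conjugate F θ :=
    le_ciSup (hF.bddAbove hσ hw₀ hN θ) (midpoint ℝ w x)
  have h3 := hv (w - x)
  have h4 := mul_sub_quarter_sq_le hσ b (N (w - x))
  rw [midpoint_eq_smul_add, inner_smul_left, inner_add_left] at h2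
  rw [← midpoint_eq_smul_add] at h2
  simp only [invOf_eq_inv, conj_trivial] at h2
  rw [inner_sub_left] at h3
  rw [inner_add_right]
  linarith

/-- A sublevel set of a strongly convex function has small nets for the seminorm
`w ↦ max_i |⟪w, ψ i⟫|`; the nets are the iterates of mistake-driven mirror descent. -/
lemma MidpointStronglyConvex.exists_net {ι : Type*} [Fintype ι]
    (hF : MidpointStronglyConvex F σ N) (hσ : 0 < σ)
    (hw₀ : IsMinOn F Set.univ w₀) (hN : ∀ θ : V, ∃ b : ℝ, ∀ w, ⟪w, θ⟫_ℝ ≤ b * N w)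
    (ψ : ι → V) {B : ℝ} (hB : 0 < B) (hψ : ∀ i w, |⟪w, ψ i⟫_ℝ| ≤ B * N w)
    {Λ ε : ℝ} (hε : 0 < ε) (m : ℕ) (hm : 8 * Λ * B ^ 2 < m * (σ * ε ^ 2)) :
    ∃ T : Finset V, T.card ≤ (2 * Fintype.card ι + 1) ^ m ∧
      ∀ w, F w - F w₀ ≤ Λ → ∃ v ∈ T, ∀ i, |⟪w - v, ψ i⟫_ℝ| ≤ ε := by
  classical
  -- The step `η` maximizes the gain `η * ε - (η * B) ^ 2 / σ`, whose maximum is `2 * γ`; one `γ`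
  -- pays for the approximate maximizer.
  set γ := σ * ε ^ 2 / (8 * B ^ 2) with hγ
  have hγ0 : 0 < γ := by positivity
  set η := σ * ε / (2 * B ^ 2) with hη
  have hη0 : 0 < η := by positivity
  have hx : ∀ θ, ∃ x, conjugate F θ - γ ≤ ⟪x, θ⟫_ℝ - F x := by
    intro θ
    obtain ⟨x, hx⟩ := exists_lt_of_lt_ciSup (sub_lt_self (conjugate F θ) hγ0)
    exact ⟨x, hx.le⟩
  choose x hx using hx
  -- The vector 0 lets an iterate that is already close stay put.
  set Q : Finset V := {0} ∪ (Finset.univ.image (fun i => η • ψ i) ∪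
    Finset.univ.image fun i => -(η • ψ i)) with hQ
  have hQcard : Q.card ≤ 2 * Fintype.card ι + 1 := by
    have h1 : (Finset.univ.image (fun i => η • ψ i)).card ≤ Fintype.card ι :=
      Finset.card_image_le
    have h2 : (Finset.univ.image (fun i => -(η • ψ i))).card ≤ Fintype.card ι :=
      Finset.card_image_le
    have h3 := Finset.card_union_le {0} (Finset.univ.image (fun i => η • ψ i) ∪
      Finset.univ.image fun i => -(η • ψ i))
    have h4 := Finset.card_union_le (Finset.univ.image (fun i => η • ψ i))
      (Finset.univ.image fun i => -(η • ψ i))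
    rw [Finset.card_singleton, ← hQ] at h3
    omega
  -- The potential is the Fenchel–Young gap between `θ` and `w`: at most `Λ` at `θ = 0`, it loses
  -- `γ` at each mistake and is never negative, so fewer than `m` mistakes are possible.
  have key : ∀ k : ℕ, ∃ Θ : Finset V, Θ.card ≤ (2 * Fintype.card ι + 1) ^ k ∧
      ∀ w, F w - F w₀ ≤ Λ → ∃ θ ∈ Θ, (∀ i, |⟪w - x θ, ψ i⟫_ℝ| ≤ ε) ∨
        conjugate F θ + F w - ⟪w, θ⟫_ℝ ≤ Λ - k * γ := by
    intro k
    induction k with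
    | zero =>
      refine ⟨{0}, by simp, fun w hw => ⟨0, by simp, Or.inr ?_⟩⟩
      have : conjugate F 0 ≤ -F w₀ := by
        refine ciSup_le fun u => ?_
        have : F w₀ ≤ F u := hw₀ (Set.mem_univ _)
        simpa using this
      simp only [inner_zero_right, Nat.cast_zero, zero_mul, sub_zero]
      linarith
    | succ k ih =>
      obtain ⟨Θ, hΘ, h⟩ := ih
      refine ⟨(Θ ×ˢ Q).image fun p => p.1 + p.2, ?_, fun w hw => ?_⟩
      · refine Finset.card_image_le.trans ?_
        rw [Finset.card_product, pow_succ]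
        exact Nat.mul_le_mul hΘ hQcard
      · obtain ⟨θ, hθ, hor⟩ := h w hw
        by_cases hclose : ∀ i, |⟪w - x θ, ψ i⟫_ℝ| ≤ ε
        · refine ⟨θ, Finset.mem_image.2 ⟨(θ, 0), ?_, by simp⟩, Or.inl hclose⟩
          exact Finset.mem_product.2 ⟨hθ, by simp [hQ]⟩
        · have hpot := hor.resolve_left hclose
          push Not at hclose
          obtain ⟨i, hi⟩ := hclose
          have hstep : ∃ v ∈ Q, (∀ u, ⟪u, v⟫_ℝ ≤ (η * B) * N u) ∧ η * ε ≤ ⟪w - x θ, v⟫_ℝ := by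
            have habs : ∀ u, |⟪u, η • ψ i⟫_ℝ| ≤ (η * B) * N u := fun u => by
              rw [inner_smul_right, abs_mul, abs_of_pos hη0, mul_assoc]
              exact mul_le_mul_of_nonneg_left (hψ i u) hη0.le
            rcases lt_abs.1 hi with hi | hi
            · refine ⟨η • ψ i, by simp [hQ], fun u => (le_abs_self _).trans (habs u), ?_⟩
              rw [inner_smul_right]
              exact mul_le_mul_of_nonneg_left hi.le hη0.le
            · refine ⟨-(η • ψ i), by simp [hQ], fun u => ?_, ?_⟩
              · rw [inner_neg_right]
                exact (neg_le_abs _).trans (habs u)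
              · rw [inner_neg_right, inner_smul_right, ← mul_neg]
                exact mul_le_mul_of_nonneg_left hi.le hη0.le
          obtain ⟨v, hvQ, hv, hvw⟩ := hstep
          refine ⟨θ + v, Finset.mem_image.2 ⟨(θ, v), Finset.mem_product.2 ⟨hθ, hvQ⟩, rfl⟩,
            Or.inr ?_⟩
          have hconj := hF.conjugate_add_le hσ hw₀ hN (hx θ) hv
          have hgain : (η * B) ^ 2 / σ - η * ε + γ = -γ := by
            rw [hη, hγ]; field_simp; ring
          rw [inner_sub_left] at hvw
          rw [inner_add_right]
          push_cast
          linarith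
  obtain ⟨Θ, hΘ, h⟩ := key m
  refine ⟨Θ.image x, Finset.card_image_le.trans hΘ, fun w hw => ?_⟩
  obtain ⟨θ, hθ, hor⟩ := h w hw
  refine ⟨x θ, Finset.mem_image_of_mem _ hθ, hor.resolve_right fun hneg => ?_⟩
  have hFY : ⟪w, θ⟫_ℝ - F w ≤ conjugate F θ := le_ciSup (hF.bddAbove hσ hw₀ hN θ) w
  have : Λ < m * γ := by
    rw [hγ, ← mul_div_assoc, lt_div_iff₀ (by positivity)]
    linarith
  linarith

end Nets

/-! ### Dual norms of the block features -/

section DualNorm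

variable {𝒳 𝒴 H : Type*} [NormedAddCommGroup H] [InnerProductSpace ℝ H] {c : ℕ}
  {N : Seminorm ℝ (HypSpace H c)}

lemma norm_apply_le (hN : ∀ w, normTwoInf w ≤ N w) (w : HypSpace H c) (j : Fin c) :
    ‖w j‖ ≤ N w :=
  (le_ciSup (f := fun j => ‖w j‖) (Set.finite_range _).bddAbove j).trans (hN w)

/-- Domination of the block norms makes the supremum finite and forces `w = 0` when `N w = 0`, so
normalizing `w` is legitimate. -/
lemma inner_le_dualNorm (hN : ∀ w, normTwoInf w ≤ N w) (v w : HypSpace H c) :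
    ⟪w, v⟫_ℝ ≤ dualNorm N v * N w := by
  have hbdd : BddAbove {t : ℝ | ∃ w : HypSpace H c, N w ≤ 1 ∧ t = ⟪w, v⟫_ℝ} := by
    refine ⟨∑ j, ‖v j‖, ?_⟩
    rintro _ ⟨u, hu, rfl⟩
    rw [PiLp.inner_apply]
    refine Finset.sum_le_sum fun j _ => (real_inner_le_norm _ _).trans ?_
    exact mul_le_of_le_one_left (norm_nonneg _) ((norm_apply_le hN u j).trans hu)
  rcases (apply_nonneg N w).eq_or_lt with h0 | hpos
  · have hw : w = 0 := by
      ext j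
      have := norm_apply_le hN w j
      rw [← h0] at this
      simpa using this
    simp [hw]
  · have h1 : ⟪(N w)⁻¹ • w, v⟫_ℝ ≤ dualNorm N v := by
      refine le_csSup hbdd ⟨_, ?_, rfl⟩
      rw [map_smul_eq_mul, norm_inv, Real.norm_of_nonneg hpos.le, inv_mul_cancel₀ hpos.ne']
    rw [inner_smul_left, conj_trivial, inv_mul_le_iff₀ hpos] at h1
    linarith

lemma inner_blockFeature (φ : 𝒳 → H) (w : HypSpace H c) (j : Fin c) (x : 𝒳) :
    ⟪w, blockFeature φ j x⟫_ℝ = predictor φ w x j := by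
  rw [PiLp.inner_apply, Finset.sum_eq_single j]
  · simp [blockFeature, predictor]
  · intro i _ hij
    simp [blockFeature, hij]
  · simp

lemma dualNorm_blockFeature_le (hN : ∀ w, normTwoInf w ≤ N w) (φ : 𝒳 → H) {κ : ℝ}
    (hκ : ∀ x, ‖φ x‖ ≤ κ) (j : Fin c) (x : 𝒳) :
    dualNorm N (blockFeature φ j x) ≤ supDualNorm N φ := by
  refine le_ciSup (f := fun q : 𝒳 × Fin c => dualNorm N (blockFeature φ q.2 q.1)) ⟨κ, ?_⟩ (x, j)
  rintro _ ⟨⟨x, j⟩, rfl⟩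
  refine csSup_le ⟨0, 0, by simp⟩ ?_
  rintro _ ⟨w, hw, rfl⟩
  rw [inner_blockFeature]
  refine (real_inner_le_norm _ _).trans ?_
  calc ‖w j‖ * ‖φ x‖ ≤ 1 * κ := by
        gcongr
        · exact (norm_apply_le hN w j).trans hw
        · exact hκ x
    _ = κ := one_mul κ

lemma abs_inner_blockFeature_le (hN : ∀ w, normTwoInf w ≤ N w) (φ : 𝒳 → H) {κ : ℝ}
    (hκ : ∀ x, ‖φ x‖ ≤ κ) (j : Fin c) (x : 𝒳) (w : HypSpace H c) :
    |⟪w, blockFeature φ j x⟫_ℝ| ≤ supDualNorm N φ * N w := by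
  have h : ∀ u : HypSpace H c, ⟪u, blockFeature φ j x⟫_ℝ ≤ supDualNorm N φ * N u := fun u =>
    (inner_le_dualNorm hN _ u).trans
      (mul_le_mul_of_nonneg_right (dualNorm_blockFeature_le hN φ hκ j x) (apply_nonneg N u))
  refine abs_le'.2 ⟨h w, ?_⟩
  simpa using h (-w)

end DualNorm

/-! ### Strong convexity of the regularized risk -/

section Risk

variable {𝒳 𝒴 H : Type*} [MeasurableSpace 𝒳] [MeasurableSpace 𝒴] [NormedAddCommGroup H]
  [InnerProductSpace ℝ H] {c : ℕ} {N : Seminorm ℝ (HypSpace H c)}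

/-- Adding the subgradient inequalities at the midpoint cancels the linear terms. The midpoint form
passes to the risk without any subgradient of the expected loss. -/
lemma StronglyConvex.midpoint {r : HypSpace H c → ℝ} {σ : ℝ} (hr : StronglyConvex r σ N) :
    MidpointStronglyConvex r σ N := by
  intro u v
  obtain ⟨g, hg⟩ := hr (_root_.midpoint ℝ u v)
  have h1 := hg u
  have h2 := hg v
  have hu : u - _root_.midpoint ℝ u v = (2 : ℝ)⁻¹ • (u - v) := by
    simp
  have hv : v - _root_.midpoint ℝ u v = -((2 : ℝ)⁻¹ • (u - v)) := by
    rw [← smul_neg, neg_sub]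
    simp
  have hNs : N ((2 : ℝ)⁻¹ • (u - v)) = 2⁻¹ * N (u - v) := by
    rw [map_smul_eq_mul]; norm_num
  rw [hu, hNs] at h1
  rw [hv, inner_neg_left, map_neg_eq_map, hNs] at h2
  linarith

lemma MidpointStronglyConvex.regRisk {ρ : Measure (𝒳 × 𝒴)} {ℓ : HypSpace H c → 𝒳 × 𝒴 → ℝ}
    {r : HypSpace H c → ℝ} {σ : ℝ} (hint : ∀ w, Integrable (ℓ w) ρ)
    (hconv : ∀ z, ConvexOn ℝ Set.univ (fun w => ℓ w z)) (hr : MidpointStronglyConvex r σ N) :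
    MidpointStronglyConvex (regRisk ρ ℓ r) σ N := by
  intro u v
  have h1 := hr u v
  have h2 : 2 * ∫ z, ℓ (midpoint ℝ u v) z ∂ρ ≤ (∫ z, ℓ u z ∂ρ) + ∫ z, ℓ v z ∂ρ := by
    rw [← integral_const_mul, ← integral_add (hint u) (hint v)]
    refine integral_mono ((hint _).const_mul 2) ((hint u).add (hint v)) fun z => ?_
    have := (hconv z).2 (Set.mem_univ u) (Set.mem_univ v)
      (show (0 : ℝ) ≤ 2⁻¹ by norm_num) (show (0 : ℝ) ≤ 2⁻¹ by norm_num) (by norm_num)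
    simp only [smul_eq_mul] at this
    rw [midpoint_eq_smul_add, invOf_eq_inv, smul_add]
    simp only
    linarith
  simp only [VectorLearning.regRisk]
  linarith

end Risk

/-! ### Constants and assembly of the bound -/

lemma chaining_constant_le {K : ℕ} (hK : 2 ≤ K) :
    3 * ((Nat.log 2 K + 1 : ℕ) : ℝ) * √(8 * Real.log (2 * K + 1)) + 1 ≤ 57 * Real.log K ^ 2 := by
  have hK' : (2 : ℝ) ≤ K := by exact_mod_cast hK
  have hl2 := Real.log_two_gt_d9
  set x := Real.log K with hx
  have hx2 : Real.log 2 ≤ x := Real.log_le_log (by norm_num) hK'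
  have hM : ((Nat.log 2 K + 1 : ℕ) : ℝ) ≤ 3 * x := by
    have h1 : ((2 ^ Nat.log 2 K : ℕ) : ℝ) ≤ K := by
      exact_mod_cast Nat.pow_log_le_self 2 (by omega)
    have h2 := Real.log_le_log (by positivity) h1
    rw [Nat.cast_pow, Real.log_pow] at h2
    push_cast at h2 ⊢
    nlinarith
  have hs : Real.log (2 * K + 1) ≤ 3 * x := by
    calc Real.log (2 * K + 1) ≤ Real.log ((K : ℝ) ^ 3) := by
          refine Real.log_le_log (by positivity) ?_
          nlinarith [mul_nonneg (sub_nonneg.2 hK') (sub_nonneg.2 hK'), sq_nonneg ((K : ℝ) - 2)]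
      _ = 3 * x := by rw [Real.log_pow]; norm_num [hx]
  have hsq : √(8 * Real.log (2 * K + 1)) ≤ 6 * x := by
    refine Real.sqrt_le_iff.2 ⟨by linarith, ?_⟩
    nlinarith
  -- This is `54 * x ^ 2`; the remaining 1 is below `3 * x ^ 2` because `x ≥ log 2`.
  have : 3 * ((Nat.log 2 K + 1 : ℕ) : ℝ) * √(8 * Real.log (2 * K + 1)) ≤ 3 * (3 * x) * (6 * x) := by
    gcongr
  nlinarith

/-- The empirical Rademacher complexity of a sublevel set, for any bound `B > 0` of the block
features in the dual norm. -/
lemma empiricalRademacher_sublevel_le {𝒳 𝒴 H : Type*} [NormedAddCommGroup H]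
    [InnerProductSpace ℝ H] {n c : ℕ} (hnc : 2 ≤ n * c) (φ : 𝒳 → H)
    {ℓ : HypSpace H c → 𝒳 × 𝒴 → ℝ} {F : HypSpace H c → ℝ} {N : Seminorm ℝ (HypSpace H c)}
    {L σ Λ B : ℝ} (hL : 0 < L) (hσ : 0 < σ) (hΛ : 0 < Λ) (hB : 0 < B)
    (hN : ∀ θ : HypSpace H c, ∃ b : ℝ, ∀ w, ⟪w, θ⟫_ℝ ≤ b * N w)
    (hφ : ∀ j x (w : HypSpace H c), |⟪w, blockFeature φ j x⟫_ℝ| ≤ B * N w)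
    (hlip : LossLipschitz φ ℓ L) (hF : MidpointStronglyConvex F σ N) {w₀ : HypSpace H c}
    (hw₀ : IsMinOn F Set.univ w₀) (S : Fin n → 𝒳 × 𝒴) :
    empiricalRademacher (lossClass ℓ (sublevel F w₀ Λ)) S
      ≤ 114 * L * √(2 * Λ) * B * Real.log (n * c) ^ 2 / √(n * σ) := by
  have hn : 0 < n := Nat.pos_of_ne_zero fun h => by simp [h] at hnc
  have hn' : (0 : ℝ) < n := by exact_mod_cast hn
  set ψ : Fin n × Fin c → HypSpace H c := fun p => blockFeature φ p.2 (S p.1).1 with hψ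
  set h : HypSpace H c → (Fin n × Fin c → ℝ) := fun w p => ⟪w, ψ p⟫_ℝ with hh
  set D := 2 * √(Λ / σ) * B with hD
  have hD0 : 0 < D := by positivity
  have hD2 : D ^ 2 = 4 * Λ * B ^ 2 / σ := by
    rw [hD, mul_pow, mul_pow, Real.sq_sqrt (by positivity)]; ring
  set s := Real.log (2 * (n * c : ℕ) + 1) with hs
  have hK : (2 : ℝ) ≤ (n * c : ℕ) := by exact_mod_cast hnc
  have hs0 : 0 < s := Real.log_pos (by linarith)
  have hdist : ∀ u v a, 0 ≤ a → (∀ p, |⟪u - v, ψ p⟫_ℝ| ≤ a) → dist (h u) (h v) ≤ a := by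
    intro u v a ha hp
    refine (dist_pi_le_iff ha).2 fun p => ?_
    rw [Real.dist_eq, ← inner_sub_left]
    exact hp p
  have hf : ∀ u v i, |ℓ u (S i) - ℓ v (S i)| ≤ L * dist (h u) (h v) := by
    intro u v i
    refine (hlip u v (S i)).trans (mul_le_mul_of_nonneg_left ?_ hL.le)
    refine (pi_norm_le_iff_of_nonneg dist_nonneg).2 fun j => ?_
    have := dist_le_pi_dist (h u) (h v) (i, j)
    rwa [Real.dist_eq, show h u (i, j) = predictor φ u (S i).1 j from inner_blockFeature ..,
      show h v (i, j) = predictor φ v (S i).1 j from inner_blockFeature ..] at this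
  have hnets : ∀ k : ℕ, ∃ T : Finset (HypSpace H c), (k = 0 → T = {w₀}) ∧
      (T.card : ℝ) ≤ Real.exp (3 * 4 ^ k * s) ∧
      ∀ w ∈ sublevel F w₀ Λ, ∃ v ∈ T, dist (h w) (h v) ≤ D / 2 ^ k := by
    intro k
    rcases k.eq_zero_or_pos with rfl | hk
    · refine ⟨{w₀}, fun _ => rfl, ?_, fun w hw => ⟨w₀, by simp, ?_⟩⟩
      · rw [Finset.card_singleton, Nat.cast_one]
        exact Real.one_le_exp (by positivity)
      · rw [pow_zero, div_one]
        refine hdist _ _ _ hD0.le fun p => (hφ _ _ _).trans ?_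
        have h1 := hF.add_le_of_isMinOn hw₀ w
        have h2 : F w - F w₀ ≤ Λ := hw
        have h3 : N (w - w₀) ≤ 2 * √(Λ / σ) := by
          refine abs_le_of_sq_le_sq' ?_ (by positivity) |>.2
          rw [mul_pow, Real.sq_sqrt (by positivity), ← mul_div_assoc, le_div_iff₀ hσ]
          linarith
        rw [hD, mul_comm]
        exact mul_le_mul_of_nonneg_right h3 hB.le
    -- With `3 * 4 ^ k` steps the budget is `12 * Λ * B ^ 2`, strictly above the required `8 * Λ * B
    -- ^ 2`; a factor 2 would give only equality.
    · obtain ⟨T, hT, hcover⟩ := hF.exists_net hσ hw₀ hN ψ hB (fun p => hφ p.2 (S p.1).1)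
        (Λ := Λ) (ε := D / 2 ^ k) (by positivity) (3 * 4 ^ k) (by
          have : ((3 * 4 ^ k : ℕ) : ℝ) * (σ * (D / 2 ^ k) ^ 2) = 12 * Λ * B ^ 2 := by
            rw [div_pow, hD2, ← pow_mul, mul_comm k 2, pow_mul]
            push_cast
            norm_num
            field_simp
            norm_num
          rw [this]
          have : 0 < Λ * B ^ 2 := by positivity
          linarith)
      refine ⟨T, fun h0 => absurd h0 hk.ne', ?_, fun w hw => ?_⟩
      · rw [Fintype.card_prod, Fintype.card_fin, Fintype.card_fin] at hT
        have hT' : (T.card : ℝ) ≤ (2 * (n * c : ℕ) + 1) ^ (3 * 4 ^ k) := by exact_mod_cast hT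
        refine hT'.trans (le_of_eq ?_)
        rw [hs, mul_comm (3 * 4 ^ k : ℝ), ← Real.rpow_def_of_pos (by linarith)]
        rw [← Real.rpow_natCast]
        push_cast
        rfl
      · obtain ⟨v, hv, hvw⟩ := hcover w hw
        exact ⟨v, hv, hdist _ _ _ (by positivity) hvw⟩
  choose T hT₀ hTcard hTcover using hnets
  have hW : w₀ ∈ sublevel F w₀ Λ := by simp [sublevel, hΛ.le]
  have hsum := sum_signs_le_of_nets h (fun w i => ℓ w (S i)) hn hL hD0 hs0 hf
    (sublevel F w₀ Λ) ⟨w₀, hW⟩ w₀ T (hT₀ 0 rfl) hTcard hTcover (Nat.log 2 (n * c) + 1)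
    (by
      have hc : 0 < c := Nat.pos_of_ne_zero fun h => by simp [h] at hnc
      exact (Nat.le_mul_of_pos_right n hc).trans (Nat.lt_pow_succ_log_self one_lt_two _).le)
    (fun ε => n * sSup {t : ℝ | ∃ f ∈ lossClass ℓ (sublevel F w₀ Λ),
      t = (1 / n : ℝ) * ∑ i, ((ε i : ℤ) : ℝ) * f (S i)})
    (by
      intro ε a ha
      rw [← le_div_iff₀' hn']
      refine csSup_le ⟨_, ℓ w₀, ⟨w₀, hW, rfl⟩, rfl⟩ ?_
      rintro _ ⟨_, ⟨w, hw, rfl⟩, rfl⟩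
      rw [le_div_iff₀' hn', ← mul_assoc, mul_one_div_cancel hn'.ne', one_mul]
      exact ha w hw)
  rw [← Finset.mul_sum] at hsum
  have hconst := chaining_constant_le hnc
  have hsqrt : √(Λ / σ) ≤ √(2 * Λ) / √σ := by
    rw [← Real.sqrt_div' _ hσ.le]
    gcongr
    linarith
  have hnn : √(n : ℝ) * √n = n := Real.mul_self_sqrt hn'.le
  calc empiricalRademacher (lossClass ℓ (sublevel F w₀ Λ)) S
      ≤ (1 / 2 ^ n : ℝ) * (2 ^ n * (L * D * √n * (57 * Real.log (n * c : ℕ) ^ 2)) / n) := by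
        unfold empiricalRademacher
        refine mul_le_mul_of_nonneg_left ?_ (by positivity)
        rw [le_div_iff₀' hn']
        refine hsum.trans ?_
        gcongr
    _ = 57 * L * D * Real.log (n * c) ^ 2 / √n := by
        push_cast
        field_simp
        rw [Real.sq_sqrt hn'.le]
    _ ≤ 57 * L * (2 * (√(2 * Λ) / √σ) * B) * Real.log (n * c) ^ 2 / √n := by
        rw [hD]
        gcongr
    _ = _ := by
        rw [Real.sqrt_mul hn'.le]
        field_simp
        ring

end VectorLearning

theorem theorem1 :
    ∃ C₁ : ℝ, 0 < C₁ ∧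
      ∀ (𝒳 𝒴 H : Type*) [MeasurableSpace 𝒳] [MeasurableSpace 𝒴]
        [NormedAddCommGroup H] [InnerProductSpace ℝ H] [CompleteSpace H]
        (n c : ℕ) (_hnc : 2 ≤ n * c)
        (ρ : Measure (𝒳 × 𝒴)) [IsProbabilityMeasure ρ]
        (φ : 𝒳 → H) (κ : ℝ) (_hκ : ∀ x, ‖φ x‖ ≤ κ)
        (ℓ : VectorLearning.HypSpace H c → 𝒳 × 𝒴 → ℝ)
        (r : VectorLearning.HypSpace H c → ℝ)
        (N : Seminorm ℝ (VectorLearning.HypSpace H c))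
        (_hN : ∀ w, VectorLearning.normTwoInf w ≤ N w)
        (L σ Λ : ℝ) (_hL : 0 < L) (_hσ : 0 < σ) (_hΛ : 0 < Λ)
        (_hint : ∀ w, Integrable (ℓ w) ρ)
        (_hlip : VectorLearning.LossLipschitz φ ℓ L)
        (_hconv : ∀ z, ConvexOn ℝ Set.univ (fun w => ℓ w z))
        (_hr : VectorLearning.StronglyConvex r σ N)
        (wstar : VectorLearning.HypSpace H c)
        (_hwstar : IsMinOn (VectorLearning.regRisk ρ ℓ r) Set.univ wstar)
        (S : Fin n → 𝒳 × 𝒴),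
        VectorLearning.empiricalRademacher
            (VectorLearning.lossClass ℓ
              (VectorLearning.sublevel (VectorLearning.regRisk ρ ℓ r) wstar Λ)) S
          ≤ C₁ * L * √(2 * Λ) * VectorLearning.supDualNorm N φ * (Real.log (n * c)) ^ 2
              / √(n * σ) := by
  refine ⟨114, by norm_num, ?_⟩
  intro 𝒳 𝒴 H _ _ _ _ _ n c hnc ρ _ φ κ hκ ℓ r N hN L σ Λ hL hσ hΛ hint hlip hconv hr wstar
    hwstar S
  have hnc' : (1 : ℝ) < n * c := by exact_mod_cast hnc
  have hn : (0 : ℝ) < n := by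
    rcases n.eq_zero_or_pos with rfl | h
    · simp at hnc
    · exact_mod_cast h
  have hlog : 0 < Real.log (n * c) := Real.log_pos hnc'
  set C := 114 * L * √(2 * Λ) * Real.log (n * c) ^ 2 / √(n * σ) with hC
  have hC0 : 0 < C := by positivity
  have hC' : ∀ B, 114 * L * √(2 * Λ) * B * Real.log (n * c) ^ 2 / √(n * σ) = C * B := fun B => by
    rw [hC]; ring
  have habs := VectorLearning.abs_inner_blockFeature_le hN φ hκ (c := c)
  have hB0 : 0 ≤ VectorLearning.supDualNorm N φ := by
    refine Real.iSup_nonneg fun q => Real.sSup_nonneg' ⟨0, ⟨0, by simp⟩, le_rfl⟩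
  rw [hC', ← div_le_iff₀' hC0]
  -- The supremum of the dual norms may vanish while the nets need `B > 0`, so the bound is proved
  -- for every larger `B`.
  refine le_of_forall_gt_imp_ge_of_dense fun B hB => ?_
  rw [div_le_iff₀' hC0, ← hC']
  exact VectorLearning.empiricalRademacher_sublevel_le hnc φ hL hσ hΛ (hB0.trans_lt hB)
    (fun θ => ⟨_, VectorLearning.inner_le_dualNorm hN θ⟩)
    (fun j x w => (habs j x w).trans (mul_le_mul_of_nonneg_right hB.le (apply_nonneg N w)))
    hlip (VectorLearning.MidpointStronglyConvex.regRisk hint hconv hr.midpoint) hwstar S
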